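/- A partially ordered set is of finite length if there is a natural number $n$ such that none of its chains has more than $n+1$ elements. A tolerance on a lattice $L$ is a reflexive and symmetric relation $T\subseteq L\times L$ that is preserved by both lattice operations; its blocks are the maximal subsets $X\subseteq L$ with $X\times X\subseteq T$. A tolerance on a modular lattice of finite length is a doubling tolerance if each of its blocks has at most two elements. For a doubling tolerance $T$ on a modular lattice $L$ of finite length, let $\pi$ be the componentwise order on $L\times\{0,1\}$ (where $0<1$), that is, $(a,i)\mathrel{\pi}(b,j)$ if and only if $a\le b$ and $i\le j$. Let $\tau$ consist of the pairs $\big((a,1),(b,0)\big)$ such that the interval $[a,b]$ is a two-element block of $T$. Let $\rho$ be the transitive closure of $\pi\cup\tau$. Theorem. Let $T$ be a doubling tolerance on a modular lattice $L$ of finite length. Then $\rho$ is a partial order on $L\times\{0,1\}$, and $(L\times\{0,1\};\rho)$ is a modular lattice of finite length. If, in addition, $L$ is distributive, then $(L\times\{0,1\};\rho)$ is a distributive lattice. -/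

import Mathlib

/-- A partially ordered set (or any set with a relation `≤`) is of finite length if there is a
natural number `n` such that no chain in it has more than `n + 1` elements. -/
def FiniteLength (P : Type*) [LE P] : Prop :=
  ∃ n : ℕ, ∀ C : Set P, IsChain (· ≤ ·) C → C.encard ≤ (n : ℕ∞) + 1

/-- Distributivity of a lattice, as a proposition. -/
def IsDistributiveLattice (P : Type*) [Lattice P] : Prop :=
  ∀ x y z : P, x ⊓ (y ⊔ z) = (x ⊓ y) ⊔ (x ⊓ z)

/-- A (compatible) tolerance on a lattice: a reflexive and symmetric relation that is preserved by
both lattice operations. -/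
structure LatticeTolerance (L : Type*) [Lattice L] where
  rel : L → L → Prop
  refl' : ∀ a, rel a a
  symm' : ∀ a b, rel a b → rel b a
  sup' : ∀ a b c d, rel a b → rel c d → rel (a ⊔ c) (b ⊔ d)
  inf' : ∀ a b c d, rel a b → rel c d → rel (a ⊓ c) (b ⊓ d)

namespace LatticeTolerance

variable {L : Type*} [Lattice L] (T : LatticeTolerance L)

/-- The blocks of `T` are the maximal subsets `X` of `L` with `X × X ⊆ T`. -/
def IsBlock (X : Set L) : Prop :=
  Maximal (fun Y : Set L => ∀ a ∈ Y, ∀ b ∈ Y, T.rel a b) X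

/-- Every block has at most two elements. -/
def IsDoubling : Prop :=
  ∀ X : Set L, T.IsBlock X → X.encard ≤ 2

/-- The interval `[a, b]` is a two-element block of `T`. -/
def BlockCovers (a b : L) : Prop :=
  T.IsBlock (Set.Icc a b) ∧ (Set.Icc a b).encard = 2

/-- The extra steps, from `(a, 1)` up to `(b, 0)`, for each two-element block `[a, b]`. -/
def tau (x y : L × Fin 2) : Prop :=
  x.2 = 1 ∧ y.2 = 0 ∧ T.BlockCovers x.1 y.1

/-- The transitive closure of the union of the product order and `tau`. -/
def rho : L × Fin 2 → L × Fin 2 → Prop :=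
  Relation.TransGen (fun x y => x ≤ y ∨ T.tau x y)

/-- The doubled structure: the set `L × {0, 1}` with the relation `rho` as `≤`. -/
def Doubled {L : Type*} [Lattice L] (_T : LatticeTolerance L) : Type _ := L × Fin 2

instance instLEDoubled : LE T.Doubled := ⟨T.rho⟩

end LatticeTolerance

/-!
Call `c < d` with `T c d` a step of `T`. For a doubling tolerance the steps are exactly the
two-element blocks, so `(a, i)` is below `(b, j)` in the doubled structure iff `a ≤ b` and, when
`i = 1` and `j = 0`, the interval `[a, b]` contains a step. By modularity steps descend to one half
of a subdivided interval, which makes this order a lattice over `L`, and they transfer between the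
perspective intervals `[a ⊓ b, b]` and `[a, a ⊔ b]`.

Modularity and distributivity amount to uniqueness of relative complements (of comparable elements
in the modular case). As that property holds in `L`, only the pair `(a, 0)`, `(a, 1)` could violate
it. If both had the same meet and the same join with some `(b, j)`, then `[a ⊓ b, a]` and
`[a ⊓ b, b]` would each contain a step, and moving the two steps up to a common lower end would give
a block with more than two elements.
-/

section UniqueRelativeComplements

variable {P : Type*} [Lattice P]

theorem isModularLattice_of_eq_of_le_of_inf_eq_of_sup_eq
    (h : ∀ x y z : P, x ≤ z → x ⊓ y = z ⊓ y → x ⊔ y = z ⊔ y → x = z) : IsModularLattice P where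
  sup_inf_le_assoc_of_le {x} y {z} hxz := by
    have hle : x ⊔ y ⊓ z ≤ (x ⊔ y) ⊓ z :=
      sup_le (le_inf le_sup_left hxz) (inf_le_inf_right z le_sup_right)
    have hinf : (x ⊔ y) ⊓ z ⊓ y ≤ x ⊔ y ⊓ z :=
      le_sup_of_le_right (le_inf inf_le_right (inf_le_left.trans inf_le_right))
    have hsup : (x ⊔ y) ⊓ z ≤ x ⊔ y ⊓ z ⊔ y :=
      inf_le_left.trans (sup_le_sup_right le_sup_left y)
    exact (h _ y _ hle (le_antisymm (inf_le_inf_right y hle) (le_inf hinf inf_le_right))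
      (le_antisymm (sup_le_sup_right hle y) (sup_le hsup le_sup_right))).ge

theorem isDistributiveLattice_of_eq_of_inf_eq_of_sup_eq
    (h : ∀ x y z : P, x ⊓ y = z ⊓ y → x ⊔ y = z ⊔ y → x = z) : IsDistributiveLattice P := by
  have := isModularLattice_of_eq_of_le_of_inf_eq_of_sup_eq fun x y z _ => h x y z
  intro x y z
  -- `y ⊓ z ⊔ x ⊓ (y ⊔ z)` and its mirror image under `x ↔ z` have the same meet and join with `y`.
  have hmod (x z : P) : y ⊓ z ⊔ x ⊓ (y ⊔ z) = (y ⊓ z ⊔ x) ⊓ (y ⊔ z) :=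
    (sup_inf_assoc_of_le x inf_le_sup).symm
  have hinf (x z : P) : (y ⊓ z ⊔ x ⊓ (y ⊔ z)) ⊓ y = y ⊓ z ⊔ y ⊓ x := by
    rw [hmod, inf_assoc, inf_eq_right.2 (le_sup_left : y ≤ y ⊔ z),
      sup_inf_assoc_of_le x inf_le_left, inf_comm x y]
  have hsup (x z : P) : (y ⊓ z ⊔ x ⊓ (y ⊔ z)) ⊔ y = (y ⊔ x) ⊓ (y ⊔ z) := by
    rw [sup_right_comm, sup_eq_right.2 (inf_le_left : y ⊓ z ≤ y),
      sup_inf_assoc_of_le x le_sup_left]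
  have hmirror : y ⊓ z ⊔ x ⊓ (y ⊔ z) = y ⊓ x ⊔ z ⊓ (y ⊔ x) :=
    h _ y _ (by rw [hinf, hinf, sup_comm]) (by rw [hsup, hsup, inf_comm])
  calc x ⊓ (y ⊔ z) = x ⊓ (y ⊓ z ⊔ x ⊓ (y ⊔ z)) := by
        rw [hmod, ← inf_assoc, inf_eq_left.2 (le_sup_right : x ≤ y ⊓ z ⊔ x)]
    _ = x ⊓ (y ⊓ x ⊔ z ⊓ (y ⊔ x)) := by rw [hmirror]
    _ = (y ⊓ x ⊔ z) ⊓ x := by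
        rw [hmod, inf_comm, inf_assoc, inf_eq_right.2 (le_sup_right : x ≤ y ⊔ x)]
    _ = x ⊓ y ⊔ x ⊓ z := by
        rw [sup_inf_assoc_of_le z inf_le_right, inf_comm y, inf_comm z]

theorem IsDistributiveLattice.eq_of_inf_eq_of_sup_eq (hP : IsDistributiveLattice P) {x y z : P}
    (hinf : x ⊓ y = z ⊓ y) (hsup : x ⊔ y = z ⊔ y) : x = z :=
  let := DistribLattice.ofInfSupLe fun x y z : P => (hP x y z).le
  eq_of_inf_eq_sup_eq hinf hsup

end UniqueRelativeComplements

theorem FiniteLength.of_map_le_of_injective {P Q κ : Type*} [LE P] [LE Q] [Finite κ]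
    (hP : FiniteLength P) (f : Q → P) (g : Q → κ) (hf : ∀ x y, x ≤ y → f x ≤ f y)
    (hfg : Function.Injective fun x => (f x, g x)) : FiniteLength Q := by
  obtain ⟨n, hn⟩ := hP
  refine ⟨(n + 1) * Nat.card κ, fun C hC => ?_⟩
  have hmaps : Set.MapsTo (fun x => (f x, g x)) C ((f '' C) ×ˢ Set.univ) :=
    fun x hx => ⟨Set.mem_image_of_mem f hx, trivial⟩
  calc C.encard ≤ ((f '' C) ×ˢ (Set.univ : Set κ)).encard :=
        Set.encard_le_encard_of_injOn hmaps hfg.injOn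
    _ = (f '' C).encard * Nat.card κ := by
        rw [Set.encard_prod, Set.encard_univ, ENat.card_eq_coe_natCard]
    _ ≤ (n + 1) * Nat.card κ := by
        gcongr
        exact hn _ (hC.image_of_map_rel _ _ f hf)
    _ ≤ ((n + 1) * Nat.card κ : ℕ) + 1 := by
        push_cast
        exact le_self_add

theorem covBy_of_encard_Icc_eq_two {P : Type*} [PartialOrder P] {a b : P}
    (h : (Set.Icc a b).encard = 2) : a ⋖ b := by
  have hnontrivial : (Set.Icc a b).Nontrivial :=
    Set.one_lt_encard_iff_nontrivial.1 (by rw [h]; norm_num)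
  obtain ⟨e, he⟩ := hnontrivial.nonempty
  have hle : a ≤ b := he.1.trans he.2
  have hne : a ≠ b := by
    rintro rfl
    simp at hnontrivial
  have hpair : ({a, b} : Set P) = Set.Icc a b :=
    (Set.toFinite _).eq_of_subset_of_encard_le
      (Set.pair_subset (Set.left_mem_Icc.2 hle) (Set.right_mem_Icc.2 hle))
      (h.trans (Set.encard_pair hne).symm).le
  refine ⟨hle.lt_of_ne hne, fun c hac hcb => ?_⟩
  rcases hpair.ge ⟨hac.le, hcb.le⟩ with rfl | rfl
  · exact hac.false
  · exact hcb.false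

theorem exists_superset_maximal_forall_rel {α : Type*} {r : α → α → Prop} {X : Set α}
    (hX : ∀ a ∈ X, ∀ b ∈ X, r a b) :
    ∃ B, X ⊆ B ∧ Maximal (fun Y : Set α => ∀ a ∈ Y, ∀ b ∈ Y, r a b) B := by
  refine zorn_subset_nonempty {Y : Set α | ∀ a ∈ Y, ∀ b ∈ Y, r a b} ?_ X hX
  rintro c hc hchain -
  refine ⟨⋃₀ c, ?_, fun s hs => Set.subset_sUnion_of_mem hs⟩
  rintro a ⟨s, hs, has⟩ b ⟨t, ht, hbt⟩
  rcases hchain.total hs ht with hst | hts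
  · exact hc ht a (hst has) b hbt
  · exact hc hs a has b (hts hbt)

namespace LatticeTolerance

section Steps

variable {L : Type*} [Lattice L] {T : LatticeTolerance L} {a b c d s : L}

/-- A step of `T` is a pair of distinct comparable elements related by `T`. -/
def IsStep (T : LatticeTolerance L) (a b : L) : Prop :=
  a < b ∧ T.rel a b

/-- The interval `[a, b]` contains a step of `T`; this is the condition for `(a, 1)` to lie below
`(b, 0)` in the doubled structure. -/
def HasStep (T : LatticeTolerance L) (a b : L) : Prop :=
  ∃ c d, a ≤ c ∧ T.IsStep c d ∧ d ≤ b

theorem IsStep.hasStep (h : T.IsStep a b) : T.HasStep a b :=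
  ⟨a, b, le_rfl, h, le_rfl⟩

theorem HasStep.lt (h : T.HasStep a b) : a < b :=
  let ⟨_, _, hac, hcd, hdb⟩ := h
  hac.trans_lt (hcd.1.trans_le hdb)

theorem HasStep.mono (h : T.HasStep c d) (hac : a ≤ c) (hdb : d ≤ b) : T.HasStep a b :=
  let ⟨e, f, hce, hef, hfd⟩ := h
  ⟨e, f, hac.trans hce, hef, hfd.trans hdb⟩

theorem rel_of_mem_Icc (h : T.rel a b) (hc : c ∈ Set.Icc a b) (hd : d ∈ Set.Icc a b) :
    T.rel c d := by
  have rel_right {e : L} (he : e ∈ Set.Icc a b) : T.rel e b := by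
    simpa only [sup_eq_right.2 he.1, sup_eq_left.2 he.2] using T.sup' _ _ _ _ h (T.refl' e)
  simpa only [inf_eq_left.2 hc.2, inf_eq_right.2 hd.2] using
    T.inf' _ _ _ _ (rel_right hc) (T.symm' _ _ (rel_right hd))

theorem BlockCovers.isStep (h : T.BlockCovers a b) : T.IsStep a b := by
  have hlt : a < b := (covBy_of_encard_Icc_eq_two h.2).lt
  exact ⟨hlt, h.1.prop a (Set.left_mem_Icc.2 hlt.le) b (Set.right_mem_Icc.2 hlt.le)⟩

theorem IsDoubling.blockCovers_of_isStep (hT : T.IsDoubling) (h : T.IsStep a b) :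
    T.BlockCovers a b := by
  obtain ⟨B, hIB, hB⟩ :=
    exists_superset_maximal_forall_rel fun c hc d hd => rel_of_mem_Icc h.2 (c := c) (d := d) hc hd
  have hpair : ({a, b} : Set L) ⊆ Set.Icc a b :=
    Set.pair_subset (Set.left_mem_Icc.2 h.1.le) (Set.right_mem_Icc.2 h.1.le)
  have hpairB : ({a, b} : Set L) = B :=
    (Set.toFinite _).eq_of_subset_of_encard_le (hpair.trans hIB)
      ((hT B hB).trans_eq (Set.encard_pair h.1.ne).symm)
  have hIcc : Set.Icc a b = B := hIB.antisymm (hpairB ▸ hpair)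
  exact ⟨hIcc ▸ hB, by rw [hIcc, ← hpairB, Set.encard_pair h.1.ne]⟩

theorem IsDoubling.covBy_of_isStep (hT : T.IsDoubling) (h : T.IsStep a b) : a ⋖ b :=
  covBy_of_encard_Icc_eq_two (hT.blockCovers_of_isStep h).2

theorem IsDoubling.eq_of_isStep (hT : T.IsDoubling) (hb : T.IsStep a b) (hc : T.IsStep a c) :
    b = c := by
  have hrel : T.rel a (b ⊔ c) := by
    simpa only [sup_idem] using T.sup' _ _ _ _ hb.2 hc.2
  have hcov : a ⋖ b ⊔ c := hT.covBy_of_isStep ⟨lt_sup_of_lt_left hb.1, hrel⟩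
  exact (le_sup_left.eq_of_not_lt (hcov.2 hb.1)).trans
    (le_sup_right.eq_of_not_lt (hcov.2 hc.1)).symm

theorem IsStep.sup_of_not_le_sup (h : T.IsStep c d) (hd : ¬d ≤ c ⊔ s) :
    T.IsStep (c ⊔ s) (d ⊔ s) :=
  ⟨lt_of_le_not_ge (sup_le_sup_right h.1.le s) fun hle => hd (le_sup_left.trans hle),
    T.sup' _ _ _ _ h.2 (T.refl' s)⟩

variable [IsModularLattice L]

theorem IsStep.sup_of_inf_le (h : T.IsStep c d) (hc : d ⊓ s ≤ c) : T.IsStep (c ⊔ s) (d ⊔ s) :=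
  ⟨sup_lt_sup_of_lt_of_inf_le_inf h.1 (le_inf hc inf_le_right), T.sup' _ _ _ _ h.2 (T.refl' s)⟩

theorem IsStep.inf_of_le_sup (h : T.IsStep c d) (hd : d ≤ c ⊔ s) : T.IsStep (c ⊓ s) (d ⊓ s) :=
  ⟨inf_lt_inf_of_lt_of_sup_le_sup h.1 (sup_le hd le_sup_right), T.inf' _ _ _ _ h.2 (T.refl' s)⟩

theorem HasStep.or_of_le_of_le (h : T.HasStep a b) (has : a ≤ s) (hsb : s ≤ b) :
    T.HasStep a s ∨ T.HasStep s b := by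
  obtain ⟨c, d, hac, hcd, hdb⟩ := h
  by_cases hd : d ≤ c ⊔ s
  · exact .inl ((hcd.inf_of_le_sup hd).hasStep.mono (le_inf hac has) inf_le_right)
  · exact .inr ((hcd.sup_of_not_le_sup hd).hasStep.mono le_sup_right (sup_le hdb hsb))

theorem hasStep_sup_iff_hasStep_inf : T.HasStep a (a ⊔ b) ↔ T.HasStep (a ⊓ b) b := by
  constructor <;> rintro ⟨c, d, hac, hcd, hdb⟩
  · exact (hcd.inf_of_le_sup (hdb.trans (sup_le_sup_right hac b))).hasStep.mono
      (inf_le_inf_right b hac) inf_le_right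
  · exact (hcd.sup_of_inf_le (s := a) ((le_inf inf_le_right (inf_le_left.trans hdb)).trans hac))
      |>.hasStep.mono le_sup_right (sup_le (hdb.trans le_sup_right) le_sup_left)

theorem IsDoubling.not_hasStep_inf_right (hT : T.IsDoubling) (ha : T.HasStep (a ⊓ b) a) :
    ¬T.HasStep (a ⊓ b) b := by
  rintro ⟨c', d', hc', hcd', hd'⟩
  obtain ⟨c, d, hc, hcd, hd⟩ := ha
  have hstep : T.IsStep (c ⊔ c') (d ⊔ c') :=
    hcd.sup_of_inf_le ((inf_le_inf hd (hcd'.1.le.trans hd')).trans hc)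
  have hstep' : T.IsStep (c ⊔ c') (c ⊔ d') := by
    rw [sup_comm c, sup_comm c]
    exact hcd'.sup_of_inf_le ((le_inf (inf_le_right.trans (hcd.1.le.trans hd))
      (inf_le_left.trans hd')).trans hc')
  have heq : d ⊔ c' = c ⊔ d' := hT.eq_of_isStep hstep hstep'
  have hlt : c ⊔ d' < d ⊔ d' := (hcd.sup_of_inf_le ((inf_le_inf hd hd').trans hc)).1
  exact hlt.not_ge (sup_le (le_sup_left.trans heq.le) le_sup_right)

end Steps

section DoubledOrder

variable {L : Type*} [Lattice L] {T : LatticeTolerance L} {x y z : L × Fin 2}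

/-- The order of the doubled structure without reference to a transitive closure; it agrees with
`rho` for doubling tolerances and is used to build the lattice structure. -/
def doubledLE (T : LatticeTolerance L) (x y : L × Fin 2) : Prop :=
  x.1 ≤ y.1 ∧ (x.2 = 1 → y.2 = 0 → T.HasStep x.1 y.1)

theorem doubledLE_refl (x : L × Fin 2) : T.doubledLE x x :=
  ⟨le_rfl, fun h₁ h₀ => absurd (h₁.symm.trans h₀) one_ne_zero⟩

theorem doubledLE_trans (hxy : T.doubledLE x y) (hyz : T.doubledLE y z) : T.doubledLE x z := by
  refine ⟨hxy.1.trans hyz.1, fun hx hz => ?_⟩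
  rcases Fin.exists_fin_two.1 ⟨y.2, rfl⟩ with hy | hy
  · exact (hxy.2 hx hy).mono le_rfl hyz.1
  · exact (hyz.2 hy hz).mono hxy.1 le_rfl

theorem doubledLE_antisymm (hxy : T.doubledLE x y) (hyx : T.doubledLE y x) : x = y := by
  have hfst : x.1 = y.1 := le_antisymm hxy.1 hyx.1
  have hnot₁₀ : ¬(x.2 = 1 ∧ y.2 = 0) := fun h => (hxy.2 h.1 h.2).lt.ne hfst
  have hnot₀₁ : ¬(y.2 = 1 ∧ x.2 = 0) := fun h => (hyx.2 h.1 h.2).lt.ne hfst.symm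
  exact Prod.ext hfst (by omega)

theorem doubledLE_of_rho (h : T.rho x y) : T.doubledLE x y := by
  have of_generator (u v : L × Fin 2) : u ≤ v ∨ T.tau u v → T.doubledLE u v := by
    rintro (huv | ⟨-, -, huv⟩)
    · exact ⟨huv.1, fun hu hv => absurd (hu ▸ hv ▸ huv.2 : (1 : Fin 2) ≤ 0) (by decide)⟩
    · exact ⟨huv.isStep.1.le, fun _ _ => huv.isStep.hasStep⟩
  induction h with
  | single huv => exact of_generator _ _ huv
  | tail _ huv ih => exact doubledLE_trans ih (of_generator _ _ huv)

theorem IsDoubling.rho_iff_doubledLE (hT : T.IsDoubling) : T.rho x y ↔ T.doubledLE x y := by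
  refine ⟨doubledLE_of_rho, fun ⟨hle, hstep⟩ => ?_⟩
  by_cases hxy : x.2 = 1 ∧ y.2 = 0
  · obtain ⟨c, d, hc, hcd, hd⟩ := hstep hxy.1 hxy.2
    have hxc : x ≤ (c, 1) := ⟨hc, hxy.1.le⟩
    have htau : T.tau (c, 1) (d, 0) := ⟨rfl, rfl, hT.blockCovers_of_isStep hcd⟩
    have hdy : (d, 0) ≤ y := ⟨hd, hxy.2.ge⟩
    exact ((Relation.TransGen.single (.inl hxc)).tail (.inr htau)).tail (.inl hdy)
  · exact .single (.inl ⟨hle, by omega⟩)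

theorem finiteLength_doubled (T : LatticeTolerance L) (hL : FiniteLength L) :
    FiniteLength T.Doubled :=
  hL.of_map_le_of_injective (Prod.fst : L × Fin 2 → L) Prod.snd
    (fun _ _ hxy => (doubledLE_of_rho hxy).1) Function.injective_id

end DoubledOrder

section DoubledLattice

variable {L : Type*} [Lattice L] {T : LatticeTolerance L} {x y z : L × Fin 2}

open Classical in
/-- The join of `x` and `y` for `doubledLE`: of the two elements over `x.1 ⊔ y.1`, the lower one if
it is an upper bound of `x` and `y`. -/
noncomputable def doubledSup (T : LatticeTolerance L) (x y : L × Fin 2) : L × Fin 2 :=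
  (x.1 ⊔ y.1,
    if (x.2 = 1 → T.HasStep x.1 (x.1 ⊔ y.1)) ∧ (y.2 = 1 → T.HasStep y.1 (x.1 ⊔ y.1)) then 0 else 1)

open Classical in
/-- The meet of `x` and `y` for `doubledLE`: of the two elements over `x.1 ⊓ y.1`, the upper one if
it is a lower bound of `x` and `y`. -/
noncomputable def doubledInf (T : LatticeTolerance L) (x y : L × Fin 2) : L × Fin 2 :=
  (x.1 ⊓ y.1,
    if (x.2 = 0 → T.HasStep (x.1 ⊓ y.1) x.1) ∧ (y.2 = 0 → T.HasStep (x.1 ⊓ y.1) y.1) then 1 else 0)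

theorem doubledSup_snd_eq_zero_iff : (T.doubledSup x y).2 = 0 ↔
    (x.2 = 1 → T.HasStep x.1 (x.1 ⊔ y.1)) ∧ (y.2 = 1 → T.HasStep y.1 (x.1 ⊔ y.1)) := by
  simp [doubledSup]

theorem doubledInf_snd_eq_one_iff : (T.doubledInf x y).2 = 1 ↔
    (x.2 = 0 → T.HasStep (x.1 ⊓ y.1) x.1) ∧ (y.2 = 0 → T.HasStep (x.1 ⊓ y.1) y.1) := by
  simp [doubledInf]

variable [IsModularLattice L]

theorem doubledSup_le (hx : T.doubledLE x z) (hy : T.doubledLE y z) :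
    T.doubledLE (T.doubledSup x y) z := by
  have hle : x.1 ⊔ y.1 ≤ z.1 := sup_le hx.1 hy.1
  refine ⟨hle, fun h₁ hz => by_contra fun hnot => ?_⟩
  have h₀ : (T.doubledSup x y).2 = 0 := doubledSup_snd_eq_zero_iff.2
    ⟨fun hx₁ => ((hx.2 hx₁ hz).or_of_le_of_le le_sup_left hle).resolve_right hnot,
      fun hy₁ => ((hy.2 hy₁ hz).or_of_le_of_le le_sup_right hle).resolve_right hnot⟩
  exact one_ne_zero (h₁.symm.trans h₀)

theorem le_doubledInf (hx : T.doubledLE z x) (hy : T.doubledLE z y) :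
    T.doubledLE z (T.doubledInf x y) := by
  have hle : z.1 ≤ x.1 ⊓ y.1 := le_inf hx.1 hy.1
  refine ⟨hle, fun hz h₀ => by_contra fun hnot => ?_⟩
  have h₁ : (T.doubledInf x y).2 = 1 := doubledInf_snd_eq_one_iff.2
    ⟨fun hx₀ => ((hx.2 hz hx₀).or_of_le_of_le hle inf_le_left).resolve_left hnot,
      fun hy₀ => ((hy.2 hz hy₀).or_of_le_of_le hle inf_le_right).resolve_left hnot⟩
  exact one_ne_zero (h₁.symm.trans h₀)

/-- The lattice structure on the doubled set with order `doubledLE`. It is not an instance, because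
`T.Doubled` already carries the order `rho`, which differs from `doubledLE` for a general
tolerance. -/
noncomputable abbrev doubledLattice (T : LatticeTolerance L) : Lattice T.Doubled where
  le := T.doubledLE
  le_refl := doubledLE_refl
  le_trans _ _ _ := doubledLE_trans
  le_antisymm _ _ := doubledLE_antisymm
  sup := T.doubledSup
  inf := T.doubledInf
  le_sup_left _ _ := ⟨le_sup_left, fun hx h => (doubledSup_snd_eq_zero_iff.1 h).1 hx⟩
  le_sup_right _ _ := ⟨le_sup_right, fun hy h => (doubledSup_snd_eq_zero_iff.1 h).2 hy⟩
  sup_le _ _ _ := doubledSup_le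
  inf_le_left _ _ := ⟨inf_le_left, fun h hx => (doubledInf_snd_eq_one_iff.1 h).1 hx⟩
  inf_le_right _ _ := ⟨inf_le_right, fun h hy => (doubledInf_snd_eq_one_iff.1 h).2 hy⟩
  le_inf _ _ _ := le_doubledInf

theorem IsDoubling.doubledSup_ne_of_doubledInf_eq (hT : T.IsDoubling) {a : L}
    (hinf : T.doubledInf (a, 0) y = T.doubledInf (a, 1) y) :
    T.doubledSup (a, 0) y ≠ T.doubledSup (a, 1) y := by
  intro hsup
  have hinf_snd := congrArg (fun w => w.2 = 1) hinf
  have hsup_snd := congrArg (fun w => w.2 = 0) hsup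
  have hab : T.HasStep a (a ⊔ y.1) ↔ T.HasStep (a ⊓ y.1) y.1 := hasStep_sup_iff_hasStep_inf
  have hba : T.HasStep y.1 (a ⊔ y.1) ↔ T.HasStep (a ⊓ y.1) a := by
    rw [sup_comm, inf_comm]
    exact hasStep_sup_iff_hasStep_inf
  have hnot : T.HasStep (a ⊓ y.1) a → ¬T.HasStep (a ⊓ y.1) y.1 := hT.not_hasStep_inf_right
  simp only [doubledInf_snd_eq_one_iff, doubledSup_snd_eq_zero_iff] at hinf_snd hsup_snd
  rcases Fin.exists_fin_two.1 ⟨y.2, rfl⟩ with hy | hy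
  · have hjoin : T.HasStep a (a ⊔ y.1) := by simpa [hy] using hsup_snd
    have hmeet : T.HasStep (a ⊓ y.1) y.1 → T.HasStep (a ⊓ y.1) a := by simpa [hy] using hinf_snd
    exact hnot (hmeet (hab.1 hjoin)) (hab.1 hjoin)
  · have hmeet : T.HasStep (a ⊓ y.1) a := by simpa [hy] using hinf_snd
    have hjoin : T.HasStep y.1 (a ⊔ y.1) → T.HasStep a (a ⊔ y.1) := by simpa [hy] using hsup_snd
    exact hnot hmeet (hab.1 (hjoin (hba.2 hmeet)))

theorem IsDoubling.eq_of_fst_eq_of_doubledInf_eq_of_doubledSup_eq (hT : T.IsDoubling)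
    (hfst : x.1 = z.1) (hinf : T.doubledInf x y = T.doubledInf z y)
    (hsup : T.doubledSup x y = T.doubledSup z y) : x = z := by
  obtain ⟨a, i⟩ := x
  obtain ⟨c, k⟩ := z
  obtain rfl : a = c := hfst
  fin_cases i <;> fin_cases k
  · rfl
  · exact absurd hsup (hT.doubledSup_ne_of_doubledInf_eq hinf)
  · exact absurd hsup.symm (hT.doubledSup_ne_of_doubledInf_eq hinf.symm)
  · rfl

theorem IsDoubling.isModularLattice_doubledLattice (hT : T.IsDoubling) :
    @IsModularLattice T.Doubled T.doubledLattice := by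
  let := T.doubledLattice
  refine isModularLattice_of_eq_of_le_of_inf_eq_of_sup_eq fun x y z hxz hinf hsup => ?_
  have hfst : x.1 = z.1 := eq_of_le_of_inf_le_of_sup_le hxz.1
    (congrArg Prod.fst hinf).ge (congrArg Prod.fst hsup).ge
  exact hT.eq_of_fst_eq_of_doubledInf_eq_of_doubledSup_eq hfst hinf hsup

theorem IsDoubling.isDistributiveLattice_doubledLattice (hT : T.IsDoubling)
    (hL : IsDistributiveLattice L) : @IsDistributiveLattice T.Doubled T.doubledLattice := by
  let := T.doubledLattice
  refine isDistributiveLattice_of_eq_of_inf_eq_of_sup_eq fun x y z hinf hsup => ?_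
  have hfst : x.1 = z.1 :=
    hL.eq_of_inf_eq_of_sup_eq (congrArg Prod.fst hinf) (congrArg Prod.fst hsup)
  exact hT.eq_of_fst_eq_of_doubledInf_eq_of_doubledSup_eq hfst hinf hsup

end DoubledLattice

end LatticeTolerance

theorem mainTheorem1_general {L : Type*} [Lattice L] [IsModularLattice L]
    (T : LatticeTolerance L) (hT : T.IsDoubling) :
    (FiniteLength L → FiniteLength T.Doubled) ∧
    ∃ M : Lattice T.Doubled,
      (∀ x y : T.Doubled, M.toLE.le x y ↔ T.rho x y) ∧
      @IsModularLattice T.Doubled M ∧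
      (IsDistributiveLattice L → @IsDistributiveLattice T.Doubled M) :=
  ⟨T.finiteLength_doubled, T.doubledLattice, fun _ _ => hT.rho_iff_doubledLE.symm,
    hT.isModularLattice_doubledLattice, hT.isDistributiveLattice_doubledLattice⟩

theorem mainTheorem1 {L : Type*} [Lattice L] [IsModularLattice L] (hL : FiniteLength L)
    (T : LatticeTolerance L) (hT : T.IsDoubling) :
    FiniteLength T.Doubled ∧
    ∃ M : Lattice T.Doubled,
      (∀ x y : T.Doubled, M.toLE.le x y ↔ T.rho x y) ∧
      @IsModularLattice T.Doubled M ∧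
      (IsDistributiveLattice L → @IsDistributiveLattice T.Doubled M) :=
  (mainTheorem1_general T hT).imp_left fun hfinite => hfinite hL
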